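/- Let $\mathcal{A}$ be the disc algebra, i.e. the complex Banach algebra of all continuous functions $f:\{z\in\mathbb{C}:|z|\le 1\}\to\mathbb{C}$ that are holomorphic on $\{|z|<1\}$, with pointwise operations and the supremum norm. For every $A\in \mathrm{GL}_2(\mathcal{A})$, i.e. every invertible $2\times 2$ matrix over $\mathcal{A}$, there exist matrices $B,C\in \mathrm{M}_2(\mathcal{A})$ such that $$A=\exp(B)\exp(C),\qquad\text{where } \exp(X)=\sum_{n\ge 0}\frac{X^n}{n!}.$$ -/

import Mathlib

open scoped MatrixGroups

/-- The disc algebra: continuous functions on the closed unit disc that are holomorphic on the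
open unit disc. (`Function.extend` extends `f` by zero outside the closed disc; this does not
affect differentiability on the open disc.) As a subalgebra of `C(closed disc, ℂ)` it carries the
pointwise operations and the supremum norm. -/
noncomputable def discAlgebra : Subalgebra ℂ C(Metric.closedBall (0 : ℂ) 1, ℂ) where
  carrier := {f | DifferentiableOn ℂ
    (Function.extend (Subtype.val : Metric.closedBall (0 : ℂ) 1 → ℂ) f 0) (Metric.ball 0 1)}
  mul_mem' {f g} hf hg := by
    have h := Function.extend_mul (Subtype.val : Metric.closedBall (0 : ℂ) 1 → ℂ) f g 0 0
    rw [mul_zero] at h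
    simp only [Set.mem_ofPred_eq, ContinuousMap.coe_mul, h] at *
    exact hf.mul hg
  add_mem' {f g} hf hg := by
    have h := Function.extend_add (Subtype.val : Metric.closedBall (0 : ℂ) 1 → ℂ) f g 0 0
    rw [add_zero] at h
    simp only [Set.mem_ofPred_eq, ContinuousMap.coe_add, h] at *
    exact hf.add hg
  algebraMap_mem' c := by
    refine (differentiableOn_const c).congr fun z hz => ?_
    exact Subtype.val_injective.extend_apply _ _ (⟨z, Metric.ball_subset_closedBall hz⟩ :
      Metric.closedBall (0 : ℂ) 1)

/-- The disc algebra is complete, hence a Banach algebra. -/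
instance : CompleteSpace discAlgebra := by
  refine IsClosed.completeSpace_coe (s := (discAlgebra : Set C(Metric.closedBall (0 : ℂ) 1, ℂ)))
    (hs := ?_)
  refine isClosed_of_closure_subset fun f hf => ?_
  obtain ⟨u, hu, hlim⟩ := mem_closure_iff_seq_limit.1 hf
  have hunif := ContinuousMap.tendsto_iff_tendstoUniformly.1 hlim
  refine TendstoLocallyUniformlyOn.differentiableOn (φ := Filter.atTop)
    (F := fun n => Function.extend (Subtype.val : Metric.closedBall (0 : ℂ) 1 → ℂ) (u n) 0)
    (TendstoUniformlyOn.tendstoLocallyUniformlyOn ?_) (Filter.Eventually.of_forall hu)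
    Metric.isOpen_ball
  rw [Metric.tendstoUniformlyOn_iff]
  intro ε hε
  filter_upwards [Metric.tendstoUniformly_iff.1 hunif ε hε] with n hn z hz
  have hz' : z ∈ Metric.closedBall (0 : ℂ) 1 := Metric.ball_subset_closedBall hz
  have e (g : Metric.closedBall (0 : ℂ) 1 → ℂ) :
      Function.extend (Subtype.val : Metric.closedBall (0 : ℂ) 1 → ℂ) g 0 z = g ⟨z, hz'⟩ :=
    Subtype.val_injective.extend_apply g 0 ⟨z, hz'⟩
  rw [e, e]
  exact hn ⟨z, hz'⟩

/-!
A unit `u` of the disc algebra is joined to a nonzero constant by its dilations `z ↦ u (w * z)`,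
and the units with a logarithm form an open, hence clopen, subgroup; so every unit is an
exponential.

The disc algebra has stable rank one. Fix `g`. Among the `f` coprime to `g`, those that become a
unit after adding a multiple of `g` form a clopen set. By density of the polynomials and
multiplicativity it is enough to treat `f = z - a`, which is coprime to `g` exactly when `a` lies
outside the disc or `g a ≠ 0`. The set `T` of bad `a` is open, contained in the disc, and `g`
vanishes on its frontier; by the maximum principle `g` vanishes on `T`, so `T` is empty.

Stable rank one lets us conjugate `A` by an elementary matrix so that its upper left entry becomes
a unit. It is then a product of a lower and an upper triangular matrix, in which a large scalar can
be moved from one diagonal to the other so that the diagonal entries of each factor differ by a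
unit. Each factor is then conjugate to a diagonal matrix of exponentials.
-/

section StableRank

variable {R : Type*}

/-- The elements `f` for which the pair `(f, g)` is *reducible*, i.e. `f` becomes a unit after
adding a multiple of `g`. They form a submonoid, being the preimage under `R → R ⧸ (g)` of the image
of the units of `R`. -/
def reducibleSubmonoid [CommRing R] (g : R) : Submonoid R where
  carrier := {f | ∃ h, IsUnit (f + h * g)}
  one_mem' := ⟨0, by simp⟩
  mul_mem' := by
    rintro f₁ f₂ ⟨h₁, hu₁⟩ ⟨h₂, hu₂⟩
    refine ⟨f₁ * h₂ + h₁ * f₂ + h₁ * h₂ * g, ?_⟩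
    convert hu₁.mul hu₂ using 1
    ring

/-- A commutative ring has (Bass) stable rank one if every coprime pair is reducible. -/
def HasStableRankOne (R : Type*) [CommRing R] : Prop :=
  ∀ ⦃f g : R⦄, IsCoprime f g → f ∈ reducibleSubmonoid g

theorem mem_reducibleSubmonoid_of_isUnit [CommRing R] {f : R} (hf : IsUnit f) (g : R) :
    f ∈ reducibleSubmonoid g :=
  ⟨0, by simpa using hf⟩

theorem zero_mem_reducibleSubmonoid [CommRing R] {g : R} (hg : IsUnit g) :
    0 ∈ reducibleSubmonoid g :=
  ⟨1, by simpa using hg⟩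

/-- Modulo `g`, the unit `x * f' + y * g` times `f` is congruent to `f'`. -/
theorem mem_reducibleSubmonoid_of_isUnit_bezout [CommRing R] {f f' g x y : R}
    (hxy : x * f + y * g = 1) (hv : IsUnit (x * f' + y * g)) (hf' : f' ∈ reducibleSubmonoid g) :
    f ∈ reducibleSubmonoid g := by
  obtain ⟨h, hu⟩ := hf'
  obtain ⟨v, hv⟩ := hv
  refine ⟨↑v⁻¹ * (h - (f - f') * y), ?_⟩
  have hcongr : v * (f + ↑v⁻¹ * (h - (f - f') * y) * g) = f' + h * g := by
    linear_combination f * hv + f' * hxy + (h - (f - f') * y) * g * v.mul_inv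
  rwa [← Units.isUnit_units_mul v, hcongr]

variable [NormedCommRing R] [CompleteSpace R]

theorem isOpen_reducibleSubmonoid (g : R) : IsOpen (reducibleSubmonoid g : Set R) := by
  have : (reducibleSubmonoid g : Set R) = ⋃ h, (· + h * g) ⁻¹' {u | IsUnit u} := by
    ext f
    simp [reducibleSubmonoid]
  rw [this]
  exact isOpen_iUnion fun h => Units.isOpen.preimage (by fun_prop)

theorem isOpen_setOf_isCoprime_and_notMem_reducibleSubmonoid (g : R) :
    IsOpen {f : R | IsCoprime f g ∧ f ∉ reducibleSubmonoid g} := by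
  rw [isOpen_iff_mem_nhds]
  rintro f ⟨⟨x, y, hxy⟩, hf⟩
  have hcont : Continuous fun f' => x * f' + y * g := by fun_prop
  have hunit : ∀ᶠ f' in nhds f, IsUnit (x * f' + y * g) :=
    hcont.continuousAt.eventually (Units.isOpen.mem_nhds (by simp [hxy]))
  filter_upwards [hunit] with f' hv
  refine ⟨?_, fun hf' => hf (mem_reducibleSubmonoid_of_isUnit_bezout hxy hv hf')⟩
  obtain ⟨v, hv⟩ := hv
  exact ⟨↑v⁻¹ * x, ↑v⁻¹ * y, by rw [mul_assoc, mul_assoc, ← mul_add, ← hv, v.inv_mul]⟩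

theorem hasStableRankOne_of_dense {S : Set R} (hS : Dense S)
    (hred : ∀ f ∈ S, ∀ g, IsCoprime f g → f ∈ reducibleSubmonoid g) : HasStableRankOne R := by
  intro f g hfg
  by_contra hf
  obtain ⟨f', ⟨hcop, hnot⟩, hf'⟩ := hS.inter_open_nonempty _
    (isOpen_setOf_isCoprime_and_notMem_reducibleSubmonoid g) ⟨f, hfg, hf⟩
  exact hnot (hred f' hf' g hcop)

end StableRank

section Exponential

open NormedSpace

variable {R : Type*} [NormedCommRing R] [NormedAlgebra ℚ R] [CompleteSpace R]

variable (R) in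
/-- The units of a commutative Banach algebra that have a logarithm. -/
def expSubgroup : Subgroup Rˣ where
  carrier := {u | (u : R) ∈ Set.range exp}
  one_mem' := ⟨0, exp_zero⟩
  mul_mem' := by
    rintro u v ⟨x, hx⟩ ⟨y, hy⟩
    exact ⟨x + y, by rw [exp_add, hx, hy, Units.val_mul]⟩
  inv_mem' := by
    rintro u ⟨x, hx⟩
    refine ⟨-x, ?_⟩
    rw [← Units.mul_right_inj u, ← hx, ← exp_add, add_neg_cancel, exp_zero, hx, u.mul_inv]

theorem range_exp_mem_nhds_one : Set.range (exp : R → R) ∈ nhds (1 : R) := by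
  have hderiv : HasStrictFDerivAt exp (1 : R →L[ℚ] R) 0 :=
    hasStrictFDerivAt_exp_zero_of_radius_pos (expSeries_radius_pos ℚ R)
  have hmap : Filter.map exp (nhds (0 : R)) = nhds (exp 0) :=
    HasStrictFDerivAt.map_nhds_eq_of_equiv (f' := ContinuousLinearEquiv.refl ℚ R) hderiv
  rw [← exp_zero, ← hmap]
  exact Filter.range_mem_map

theorem isOpen_expSubgroup : IsOpen (expSubgroup R : Set Rˣ) := by
  have hnhds : Set.range exp ∈ nhds ((1 : Rˣ) : R) := range_exp_mem_nhds_one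
  exact (expSubgroup R).isOpen_of_mem_nhds (g := 1) (Units.continuous_val.continuousAt hnhds)

theorem mem_expSubgroup_of_preconnectedSpace {X : Type*} [TopologicalSpace X] [PreconnectedSpace X]
    {γ : X → Rˣ} (hγ : Continuous γ) {x₀ : X} (h₀ : γ x₀ ∈ expSubgroup R) (x : X) :
    γ x ∈ expSubgroup R := by
  have hclopen : IsClopen (γ ⁻¹' expSubgroup R) :=
    IsClopen.preimage ⟨(expSubgroup R).isClosed_of_isOpen isOpen_expSubgroup, isOpen_expSubgroup⟩ hγ
  exact (hclopen.eq_univ ⟨x₀, h₀⟩).ge (Set.mem_univ x)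

end Exponential

theorem exists_units_isUnit_sub_one_and_isUnit_mul_sub {R : Type*} [NormedRing R]
    [NormedAlgebra ℚ R] [CompleteSpace R] (u : Rˣ) (v : R) :
    ∃ t : Rˣ, IsUnit ((t : R) - 1) ∧ IsUnit ((t : R) * u - v) := by
  obtain ⟨k, hk⟩ := NormedField.exists_lt_norm ℚ
    (max (‖(1 : R)‖ * ‖(1 : R)‖) (‖(↑u⁻¹ * v : R)‖ * ‖(1 : R)‖))
  obtain ⟨hk₁, hk₂⟩ := max_lt_iff.1 hk
  have hk₀ : k ≠ 0 := norm_pos_iff.1 (hk₁.trans_le' (by positivity))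
  have hunit₁ : IsUnit (algebraMap ℚ R k - 1) := spectrum.mem_resolventSet_of_norm_lt_mul hk₁
  have hunit₂ : IsUnit (algebraMap ℚ R k - ↑u⁻¹ * v) :=
    spectrum.mem_resolventSet_of_norm_lt_mul hk₂
  refine ⟨Units.map (algebraMap ℚ R).toMonoidHom (Units.mk0 k hk₀), hunit₁, ?_⟩
  convert u.isUnit.mul hunit₂ using 1
  rw [mul_sub, u.mul_inv_cancel_left, ← Algebra.commutes]
  rfl

section MatrixExponential

open NormedSpace Matrix Matrix.GeneralLinearGroup

theorem units_conj_mem_range_exp {m 𝔸 : Type*} [Fintype m] [DecidableEq m] [NormedRing 𝔸]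
    [NormedAlgebra ℚ 𝔸] [CompleteSpace 𝔸] (U : (Matrix m m 𝔸)ˣ) {M : Matrix m m 𝔸}
    (hM : M ∈ Set.range exp) : U * M * (↑U⁻¹ : Matrix m m 𝔸) ∈ Set.range exp := by
  obtain ⟨B, rfl⟩ := hM
  exact ⟨U * B * (↑U⁻¹ : Matrix m m 𝔸), exp_units_conj U B⟩

variable {R : Type*} [NormedCommRing R] [NormedAlgebra ℚ R] [CompleteSpace R]

theorem upperTriangular_mem_range_exp {p q : Rˣ} (hp : p ∈ expSubgroup R) (hq : q ∈ expSubgroup R)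
    (hpq : IsUnit (p - q : R)) (x : R) : !![(p : R), x; 0, (q : R)] ∈ Set.range exp := by
  obtain ⟨k, rfl⟩ := hpq.dvd (a := x)
  obtain ⟨a, ha⟩ := hp
  obtain ⟨b, hb⟩ := hq
  have hdiag : !![(p : R), 0; 0, (q : R)] ∈ Set.range exp := by
    refine ⟨diagonal ![a, b], ?_⟩
    rw [exp_diagonal, Pi.exp_def, ← ha, ← hb]
    ext i j
    fin_cases i <;> fin_cases j <;> simp
  have hconj : !![(p : R), (p - q) * k; 0, (q : R)] =
      upperRightHom (-k) * !![(p : R), 0; 0, (q : R)] *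
        (upperRightHom (-k))⁻¹.val := by
    simp [sub_eq_add_neg, add_mul, mul_comm k]
  exact hconj ▸ units_conj_mem_range_exp (upperRightHom (-k)) hdiag

theorem lowerTriangular_mem_range_exp {p q : Rˣ} (hp : p ∈ expSubgroup R) (hq : q ∈ expSubgroup R)
    (hpq : IsUnit (p - q : R)) (x : R) : !![(p : R), 0; x, (q : R)] ∈ Set.range exp := by
  obtain ⟨B, hB⟩ := upperTriangular_mem_range_exp hp hq hpq x
  refine ⟨Bᵀ, ?_⟩
  rw [exp_transpose, hB]
  ext i j
  fin_cases i <;> fin_cases j <;> rfl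

theorem eq_lowerTriangular_mul_upperTriangular {R : Type*} [CommRing R]
    (A : Matrix (Fin 2) (Fin 2) R) {u : Rˣ} (hu : u = A 0 0) (t : Rˣ) :
    A = !![(t : R) * u, 0; t * A 1 0, ↑u⁻¹ * A.det] *
      !![(↑t⁻¹ : R), ↑(t * u)⁻¹ * A 0 1; 0, 1] := by
  ext i j
  fin_cases i <;> fin_cases j <;>
    simp only [Fin.zero_eta, Fin.mk_one, mul_apply, Fin.sum_univ_two, of_apply, cons_val',
      cons_val_zero, cons_val_one, cons_val_fin_one, det_fin_two, ← hu, mul_inv, Units.val_mul]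
  · linear_combination -(u : R) * t.mul_inv
  · linear_combination -A 0 1 * (↑t * ↑t⁻¹ * u.mul_inv + t.mul_inv)
  · linear_combination -A 1 0 * t.mul_inv
  · linear_combination -A 1 1 * u.mul_inv - A 1 0 * ↑u⁻¹ * A 0 1 * t.mul_inv

theorem exists_eq_exp_mul_exp_of_isUnit_apply_zero_zero (hexp : expSubgroup R = ⊤)
    (A : GL (Fin 2) R) (hA : IsUnit (A 0 0)) :
    ∃ B C : Matrix (Fin 2) (Fin 2) R, (A : Matrix (Fin 2) (Fin 2) R) = exp B * exp C := by
  have hmem (v : Rˣ) : v ∈ expSubgroup R := hexp ▸ Subgroup.mem_top v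
  obtain ⟨u, hu⟩ := hA
  obtain ⟨t, ht, htu⟩ := exists_units_isUnit_sub_one_and_isUnit_mul_sub u (↑u⁻¹ * A.det : Rˣ)
  have htinv : IsUnit (↑t⁻¹ - (1 : Rˣ) : R) := by
    convert (t⁻¹.isUnit.mul ht).neg using 1
    rw [mul_sub, t.inv_mul, mul_one, neg_sub, Units.val_one]
  obtain ⟨B, hB⟩ := lowerTriangular_mem_range_exp (hmem (t * u)) (hmem (u⁻¹ * A.det)) htu
    (t * A 1 0)
  obtain ⟨C, hC⟩ := upperTriangular_mem_range_exp (hmem t⁻¹) (hmem 1) htinv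
    ((t * u : Rˣ)⁻¹ * A 0 1)
  refine ⟨B, C, ?_⟩
  rw [hB, hC]
  exact eq_lowerTriangular_mul_upperTriangular A hu t

theorem exists_eq_exp_mul_exp (hexp : expSubgroup R = ⊤) (hsr : HasStableRankOne R)
    (A : GL (Fin 2) R) :
    ∃ B C : Matrix (Fin 2) (Fin 2) R, (A : Matrix (Fin 2) (Fin 2) R) = exp B * exp C := by
  have hcoprime : IsCoprime (A 0 0) (A 1 0) := by
    refine ⟨↑A.det⁻¹ * A 1 1, -(↑A.det⁻¹ * A 0 1), ?_⟩
    have hdet : (A.det : R) = A 0 0 * A 1 1 - A 0 1 * A 1 0 := Matrix.det_fin_two _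
    linear_combination (↑A.det⁻¹ : R) * -hdet + A.det.inv_mul
  obtain ⟨h, hh⟩ := hsr hcoprime
  let U : GL (Fin 2) R := upperRightHom h
  obtain ⟨B, C, hBC⟩ := exists_eq_exp_mul_exp_of_isUnit_apply_zero_zero hexp (U * A * U⁻¹) <| by
    convert hh using 1
    simp [U, Matrix.mul_apply, vecMul, dotProduct, Fin.sum_univ_two]
  obtain ⟨B', hB'⟩ := units_conj_mem_range_exp U⁻¹ ⟨B, rfl⟩
  obtain ⟨C', hC'⟩ := units_conj_mem_range_exp U⁻¹ ⟨C, rfl⟩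
  refine ⟨B', C', ?_⟩
  calc (A : Matrix (Fin 2) (Fin 2) R) = ↑(U⁻¹ * (U * A * U⁻¹) * U) := by group
    _ = ↑U⁻¹ * (exp B * exp C) * (U : Matrix (Fin 2) (Fin 2) R) := by simp [← hBC]
    _ = exp B' * exp C' := by simp [hB', hC', mul_assoc]

end MatrixExponential

namespace discAlgebra

open Metric Polynomial

/-- Evaluation at a point of the closed disc. -/
noncomputable def eval (z : closedBall (0 : ℂ) 1) : discAlgebra →ₐ[ℂ] ℂ :=
  (ContinuousMap.evalAlgHom ℂ ℂ z).comp discAlgebra.val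

theorem ext_eval {f g : discAlgebra} (h : ∀ z, eval z f = eval z g) : f = g :=
  Subtype.ext (ContinuousMap.ext h)

theorem norm_le_of_forall_norm_eval_le {f : discAlgebra} {C : ℝ} (hC : 0 ≤ C)
    (h : ∀ z, ‖eval z f‖ ≤ C) : ‖f‖ ≤ C :=
  (ContinuousMap.norm_le f.1 hC).2 h

/-- The extension by zero of an element of the disc algebra to the plane. -/
noncomputable def extension (f : discAlgebra) : ℂ → ℂ :=
  Function.extend Subtype.val f.1 0

theorem extension_coe (f : discAlgebra) (z : closedBall (0 : ℂ) 1) : extension f z = eval z f :=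
  Subtype.val_injective.extend_apply f.1 0 z

theorem continuousOn_extension (f : discAlgebra) :
    ContinuousOn (extension f) (closedBall 0 1) := by
  rw [continuousOn_iff_continuous_domRestrict]
  exact f.1.continuous.congr fun z => (extension_coe f z).symm

theorem diffContOnCl_extension (f : discAlgebra) : DiffContOnCl ℂ (extension f) (ball 0 1) :=
  ⟨f.2, by rw [closure_ball 0 one_ne_zero]; exact continuousOn_extension f⟩

theorem mem_of_differentiableOn {f : C(closedBall (0 : ℂ) 1, ℂ)} {F : ℂ → ℂ}
    (hF : DifferentiableOn ℂ F (ball 0 1)) (hfF : ∀ z : closedBall (0 : ℂ) 1, F z = f z) :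
    f ∈ discAlgebra :=
  hF.congr fun z hz => .trans
    (Subtype.val_injective.extend_apply f 0 ⟨z, ball_subset_closedBall hz⟩) (hfF _).symm

/-- The coordinate function `z ↦ z`. -/
noncomputable def coord : discAlgebra :=
  ⟨⟨Subtype.val, continuous_subtype_val⟩, mem_of_differentiableOn differentiableOn_id fun _ => rfl⟩

@[simp]
theorem eval_coord (z : closedBall (0 : ℂ) 1) : eval z coord = z := rfl

theorem norm_coord_le_one : ‖coord‖ ≤ 1 :=
  norm_le_of_forall_norm_eval_le zero_le_one fun z => mem_closedBall_zero_iff.1 z.2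

instance : NormOneClass discAlgebra := ⟨(norm_one : ‖(1 : C(closedBall (0 : ℂ) 1, ℂ))‖ = 1)⟩

/-- The dilation `f ↦ f (w * ·)` by an element `w` of the closed disc. -/
noncomputable def dilation (w : closedBall (0 : ℂ) 1) : discAlgebra →ₐ[ℂ] discAlgebra :=
  ((ContinuousMap.compRightAlgHom ℂ ℂ ⟨(w * ·), continuous_const_mul w⟩).comp
    discAlgebra.val).codRestrict discAlgebra fun f => by
    have hmaps : Set.MapsTo ((w : ℂ) * ·) (ball 0 1) (ball 0 1) := fun z hz => by
      rw [mem_ball_zero_iff] at hz ⊢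
      rw [norm_mul]
      exact mul_lt_one_of_nonneg_of_lt_one_right (mem_closedBall_zero_iff.1 w.2) (norm_nonneg z) hz
    exact mem_of_differentiableOn (F := extension f ∘ ((w : ℂ) * ·))
      ((diffContOnCl_extension f).differentiableOn.comp (by fun_prop) hmaps)
      fun z => extension_coe f (w * z)

theorem eval_dilation (w z : closedBall (0 : ℂ) 1) (f : discAlgebra) :
    eval z (dilation w f) = eval (w * z) f := rfl

theorem continuous_dilation (f : discAlgebra) : Continuous fun w => dilation w f :=
  have huncurry : Continuous (Function.uncurry fun w z : closedBall (0 : ℂ) 1 => f.1 (w * z)) :=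
    f.1.continuous.comp continuous_mul
  Continuous.subtype_mk (ContinuousMap.continuous_of_continuous_uncurry _ huncurry) _

theorem dilation_one (f : discAlgebra) : dilation 1 f = f :=
  ext_eval fun z => by rw [eval_dilation, one_mul]

theorem dilation_zero (f : discAlgebra) : dilation 0 f = algebraMap ℂ discAlgebra (eval 0 f) :=
  ext_eval fun z => by rw [eval_dilation, zero_mul, AlgHom.commutes, Algebra.algebraMap_self_apply]

noncomputable instance : NormedAlgebra ℚ discAlgebra :=
  NormedAlgebra.restrictScalars ℚ ℂ discAlgebra

theorem expSubgroup_eq_top : expSubgroup discAlgebra = ⊤ := by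
  refine eq_top_iff.2 fun u _ => ?_
  have : PreconnectedSpace (closedBall (0 : ℂ) 1) :=
    Subtype.preconnectedSpace (convex_closedBall 0 1).isPreconnected
  let γ (w : closedBall (0 : ℂ) 1) : discAlgebraˣ := Units.map (dilation w) u
  have hγ : Continuous γ := Units.continuous_iff.2
    ⟨continuous_dilation (u : discAlgebra), continuous_dilation (↑u⁻¹ : discAlgebra)⟩
  have hγ₀ : γ 0 ∈ expSubgroup discAlgebra := by
    refine ⟨algebraMap ℂ discAlgebra (Complex.log (eval 0 (u : discAlgebra))), ?_⟩
    have hu : eval 0 (u : discAlgebra) ≠ 0 := (u.isUnit.map (eval 0)).ne_zero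
    rw [← NormedSpace.algebraMap_exp_comm, ← Complex.exp_eq_exp_ℂ, Complex.exp_log hu]
    exact (dilation_zero (u : discAlgebra)).symm
  have hγ₁ : γ 1 = u := Units.ext (dilation_one (u : discAlgebra))
  exact hγ₁ ▸ mem_expSubgroup_of_preconnectedSpace hγ hγ₀ 1

theorem exists_hasSum_smul_coord_pow_dilation (f : discAlgebra) :
    ∃ c : ℕ → ℂ, ∀ w : closedBall (0 : ℂ) 1, ‖(w : ℂ)‖ < 1 →
      HasSum (fun n => (c n * (w : ℂ) ^ n) • coord ^ n) (dilation w f) := by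
  have hps : HasFPowerSeriesOnBall (extension f) (cauchyPowerSeries (extension f) 0 1) 0 1 := by
    exact_mod_cast (diffContOnCl_extension f).hasFPowerSeriesOnBall (R := 1) one_pos
  set P := cauchyPowerSeries (extension f) 0 1
  refine ⟨P.coeff, fun w hw => ?_⟩
  have hw' : (‖(w : ℂ)‖₊ : ENNReal) < P.radius :=
    lt_of_lt_of_le (by exact_mod_cast hw) hps.r_le
  have hsummable : Summable fun n => (P.coeff n * (w : ℂ) ^ n) • coord ^ n := by
    refine .of_norm_bounded (P.summable_norm_mul_pow hw') fun n => ?_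
    rw [norm_smul, norm_mul, norm_pow, P.norm_apply_eq_norm_coef, coe_nnnorm]
    exact mul_le_of_le_one_right (by positivity) <|
      (norm_pow_le coord n).trans (pow_le_one₀ (norm_nonneg coord) norm_coord_le_one)
  convert hsummable.hasSum
  refine ext_eval fun z => ?_
  have hwz : ((w * z : closedBall (0 : ℂ) 1) : ℂ) ∈ eball 0 1 := by
    rw [mem_eball, edist_zero_right, ← ENNReal.ofReal_one, ← ofReal_norm,
      ENNReal.ofReal_lt_ofReal_iff one_pos, unitClosedBall.coe_mul, norm_mul]
    exact mul_lt_one_of_nonneg_of_lt_one_left (norm_nonneg _) hw (mem_closedBall_zero_iff.1 z.2)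
  have htaylor := hps.hasSum hwz
  rw [zero_add, extension_coe] at htaylor
  have hterms : (fun n => P n fun _ => ((w * z : closedBall (0 : ℂ) 1) : ℂ)) =
      eval z ∘ fun n => (P.coeff n * (w : ℂ) ^ n) • coord ^ n := by
    ext n
    simp only [unitClosedBall.coe_mul, P.apply_eq_pow_smul_coeff, mul_pow, smul_eq_mul,
      Function.comp_apply, map_smul, map_pow, eval_coord]
    ring
  rw [hterms] at htaylor
  exact htaylor.unique (hsummable.hasSum.map (eval z) (map_continuous (eval z)))

theorem dilation_mem_closure_range_aeval_coord (f : discAlgebra) {w : closedBall (0 : ℂ) 1}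
    (hw : ‖(w : ℂ)‖ < 1) : dilation w f ∈ closure (Set.range (aeval (R := ℂ) coord)) := by
  obtain ⟨c, hc⟩ := exists_hasSum_smul_coord_pow_dilation f
  refine mem_closure_of_tendsto (hc w hw) (.of_forall fun s => ?_)
  exact ⟨∑ n ∈ s, C (c n * (w : ℂ) ^ n) * X ^ n, by simp [Algebra.smul_def]⟩

theorem one_mem_closure_norm_lt_one :
    (1 : closedBall (0 : ℂ) 1) ∈ closure {w : closedBall (0 : ℂ) 1 | ‖(w : ℂ)‖ < 1} := by
  rw [closure_subtype]
  have : ((↑) '' {w : closedBall (0 : ℂ) 1 | ‖(w : ℂ)‖ < 1} : Set ℂ) = ball 0 1 := by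
    ext z
    simpa using le_of_lt
  simp [this, closure_ball]

theorem denseRange_aeval_coord : DenseRange (aeval (R := ℂ) coord) := fun f => by
  have := map_mem_closure (continuous_dilation f) one_mem_closure_norm_lt_one
    fun w hw => dilation_mem_closure_range_aeval_coord f hw
  rwa [closure_closure, dilation_one] at this

theorem exists_eq_eval (φ : discAlgebra →ₐ[ℂ] ℂ) : ∃ z, φ = eval z := by
  have hz : φ coord ∈ closedBall (0 : ℂ) 1 := mem_closedBall_zero_iff.2 <|
    (AlgHom.norm_apply_le_self φ coord).trans norm_coord_le_one
  refine ⟨⟨φ coord, hz⟩, DFunLike.coe_injective ?_⟩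
  refine denseRange_aeval_coord.equalizer (map_continuous φ) (map_continuous (eval _)) ?_
  ext p
  simp [← aeval_algHom_apply]

theorem isCoprime_iff {f g : discAlgebra} :
    IsCoprime f g ↔ ∀ z, eval z f = 0 → eval z g ≠ 0 := by
  constructor
  · rintro ⟨x, y, hxy⟩ z hf hg
    simpa [hf, hg] using congrArg (eval z) hxy
  · intro h
    by_contra hfg
    have hne : Ideal.span {f, g} ≠ ⊤ := fun htop =>
      hfg (Ideal.mem_span_pair.1 (htop ▸ Submodule.mem_top (x := 1)))
    obtain ⟨M, hM, hle⟩ := Ideal.exists_le_maximal _ hne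
    obtain ⟨z, hz⟩ := exists_eq_eval (WeakDual.CharacterSpace.toAlgHom M.toCharacterSpace)
    have hvanish (x : discAlgebra) (hx : x ∈ ({f, g} : Set discAlgebra)) : eval z x = 0 := by
      rw [← hz]
      exact M.toCharacterSpace_apply_eq_zero_of_mem (hle (Ideal.subset_span hx))
    exact h z (hvanish f (by simp)) (hvanish g (by simp))

theorem isUnit_iff {f : discAlgebra} : IsUnit f ↔ ∀ z, eval z f ≠ 0 := by
  rw [← isCoprime_zero_right, isCoprime_iff]
  simp

theorem eqOn_zero_of_eqOn_frontier {T : Set ℂ} (hT : IsOpen T) (hT₁ : T ⊆ closedBall 0 1)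
    {g : discAlgebra} (hg : Set.EqOn (extension g) 0 (frontier T)) :
    Set.EqOn (extension g) 0 T := by
  have hball : T ⊆ ball 0 1 := by
    rw [← interior_closedBall (0 : ℂ) one_ne_zero]
    exact interior_maximal hT₁ hT
  exact Complex.eqOn_of_eqOn_frontier (isBounded_closedBall.subset hT₁)
    ((diffContOnCl_extension g).mono hball) diffContOnCl_const hg

theorem isCoprime_coord_sub_iff {g : discAlgebra} (a : closedBall (0 : ℂ) 1) :
    IsCoprime (coord - algebraMap ℂ discAlgebra a) g ↔ eval a g ≠ 0 := by
  simp only [isCoprime_iff, map_sub, eval_coord, AlgHom.commutes, Algebra.algebraMap_self_apply,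
    sub_eq_zero, Subtype.coe_inj, forall_eq]

theorem coord_sub_mem_reducibleSubmonoid {a : ℂ} {g : discAlgebra}
    (h : IsCoprime (coord - algebraMap ℂ discAlgebra a) g) :
    coord - algebraMap ℂ discAlgebra a ∈ reducibleSubmonoid g := by
  let ℓ (a : ℂ) : discAlgebra := coord - algebraMap ℂ discAlgebra a
  have hℓ : Continuous ℓ := continuous_const.sub (continuous_algebraMap ℂ discAlgebra)
  let T : Set ℂ := {a | IsCoprime (ℓ a) g ∧ ℓ a ∉ reducibleSubmonoid g}
  have hT : IsOpen T := (isOpen_setOf_isCoprime_and_notMem_reducibleSubmonoid g).preimage hℓ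
  have hT₁ : T ⊆ closedBall 0 1 := fun b hb => by
    by_contra hb₁
    refine hb.2 (mem_reducibleSubmonoid_of_isUnit (isUnit_iff.2 fun z hz => hb₁ ?_) g)
    convert z.2
    simpa [ℓ, sub_eq_zero, eq_comm] using hz
  have hfrontier : Set.EqOn (extension g) 0 (frontier T) := fun b hb => by
    rw [hT.frontier_eq] at hb
    lift b to closedBall (0 : ℂ) 1 using closure_minimal hT₁ isClosed_closedBall hb.1
    rw [extension_coe]
    by_contra hgb
    have hred : ℓ b ∈ reducibleSubmonoid g := by
      by_contra hnot
      exact hb.2 ⟨(isCoprime_coord_sub_iff b).2 hgb, hnot⟩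
    obtain ⟨b', hb', hb'T⟩ := mem_closure_iff.1 hb.1 _
      ((isOpen_reducibleSubmonoid g).preimage hℓ) hred
    exact hb'T.2 hb'
  by_contra hnot
  have haT : a ∈ T := ⟨h, hnot⟩
  have hga := eqOn_zero_of_eqOn_frontier hT hT₁ hfrontier haT
  lift a to closedBall (0 : ℂ) 1 using hT₁ haT
  exact (isCoprime_coord_sub_iff a).1 h (by rwa [extension_coe] at hga)

theorem aeval_coord_mem_reducibleSubmonoid {p : ℂ[X]} {g : discAlgebra}
    (h : IsCoprime (aeval coord p) g) : aeval coord p ∈ reducibleSubmonoid g := by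
  rcases eq_or_ne p 0 with rfl | hp
  · rw [map_zero, isCoprime_zero_left] at h
    rw [map_zero]
    exact zero_mem_reducibleSubmonoid h
  have hlead : IsUnit (aeval coord (C p.leadingCoeff)) :=
    (isUnit_C.2 (leadingCoeff_ne_zero.2 hp).isUnit).map _
  have hprod : aeval coord p =
      aeval coord (C p.leadingCoeff) * (p.roots.map fun a => aeval coord (X - C a)).prod := by
    conv_lhs => rw [(IsAlgClosed.splits p).eq_prod_roots]
    rw [map_mul, map_multiset_prod, Multiset.map_map]
    rfl
  rw [hprod] at h ⊢
  refine mul_mem (mem_reducibleSubmonoid_of_isUnit hlead g) (Submonoid.multiset_prod_mem _ _ ?_)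
  intro f hf
  have hfg : IsCoprime f g := h.of_isCoprime_of_dvd_left ((Multiset.dvd_prod hf).mul_left _)
  obtain ⟨a, -, rfl⟩ := Multiset.mem_map.1 hf
  rw [map_sub, aeval_X, aeval_C] at hfg ⊢
  exact coord_sub_mem_reducibleSubmonoid hfg

theorem hasStableRankOne : HasStableRankOne discAlgebra :=
  hasStableRankOne_of_dense denseRange_aeval_coord <| by
    rintro _ ⟨p, rfl⟩ g
    exact aeval_coord_mem_reducibleSubmonoid

end discAlgebra

theorem mainTheorem5 (A : GL (Fin 2) discAlgebra) :
    ∃ B C : Matrix (Fin 2) (Fin 2) discAlgebra,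
      (A : Matrix (Fin 2) (Fin 2) discAlgebra) = NormedSpace.exp B * NormedSpace.exp C :=
  exists_eq_exp_mul_exp discAlgebra.expSubgroup_eq_top discAlgebra.hasStableRankOne A
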